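/- Let $\mathcal L_{ring}=\{+,\cdot\,;0,1\}$ be the first-order language of rings, and regard $\mathbb{Q}$ as an $\mathcal L_{ring}$-structure in the usual way. Let $\phi(a,b,k)$ be the $\mathcal L_{ring}$-formula $$\phi(a,b,k):=\exists x\,\exists y\,\exists z\;\bigl(2+abk^2+bz^2=x^2+ay^2\bigr),$$ and let $\psi(n)$ be the $\mathcal L_{ring}$-formula $$\psi(n):=\forall a\,\forall b\,\Bigl(a\neq 0\wedge b\neq 0\;\to\;\bigl[\bigl\{\phi(a,b,0)\wedge\forall k\,\bigl(\phi(a,b,k)\to\phi(a,b,k+1)\bigr)\bigr\}\to\phi(a,b,n)\bigr]\Bigr),$$ where $2$ abbreviates $1+1$ and squares abbreviate products. (1) (Julia Robinson, 1949) For every $n\in\mathbb{Q}$, $$\mathbb{Q}\models\psi(n)\iff n\in\mathbb{Z}.$$ (2) The theory $\mathrm{Th}(\mathbb{Q})$, i.e. the set of all $\mathcal L_{ring}$-sentences true in $\mathbb{Q}$, is undecidable: there is no algorithm which, given as input an arbitrary $\mathcal L_{ring}$-sentence $\sigma$ (written as a string over a finite alphabet), answers YES if $\mathbb{Q}\models\sigma$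 and NO otherwise. -/

import Mathlib

namespace RingTheoryOfRat

open FirstOrder FirstOrder.Language

/-- The function symbols `+`, `·` (binary) and `0`, `1` (constants). -/
inductive RingFn : ℕ → Type
  | add : RingFn 2
  | mul : RingFn 2
  | zero : RingFn 0
  | one : RingFn 0

/-- The language of rings `{+, ·; 0, 1}`: no symbol for negation and no relation symbol
besides equality. -/
def Lring : FirstOrder.Language.{0, 0} where
  Functions := RingFn
  Relations := fun _ => Empty

/-- The terms `t + s`, `t · s`, `0`, `1`. -/
instance {α : Type} : Add (Lring.Term α) := ⟨fun t s => Term.func (L := Lring) RingFn.add ![t, s]⟩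

instance {α : Type} : Mul (Lring.Term α) := ⟨fun t s => Term.func (L := Lring) RingFn.mul ![t, s]⟩

instance {α : Type} : Zero (Lring.Term α) := ⟨Term.func (L := Lring) RingFn.zero ![]⟩

instance {α : Type} : One (Lring.Term α) := ⟨Term.func (L := Lring) RingFn.one ![]⟩

/-- The standard structure on `ℚ`: each symbol denotes the usual operation or constant. -/
instance : Lring.Structure ℚ where
  funMap := fun {_} f =>
    match f with
    | RingFn.add => fun x => x 0 + x 1
    | RingFn.mul => fun x => x 0 * x 1
    | RingFn.zero => fun _ => 0
    | RingFn.one => fun _ => 1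
  RelMap := fun {_} r => Empty.elim r

section Formulas

/-- The formula `φ(a,b,k) := ∃ x y z, 2 + a b k² + b z² = x² + a y²`, with free variables
`a, b, k` numbered `0, 1, 2` and with `2` written as `1 + 1`. -/
def phi : Lring.Formula (Fin 3) :=
  let a : Lring.Term (Fin 3 ⊕ Fin 3) := Term.var (Sum.inl 0)
  let b : Lring.Term (Fin 3 ⊕ Fin 3) := Term.var (Sum.inl 1)
  let k : Lring.Term (Fin 3 ⊕ Fin 3) := Term.var (Sum.inl 2)
  let x : Lring.Term (Fin 3 ⊕ Fin 3) := Term.var (Sum.inr 0)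
  let y : Lring.Term (Fin 3 ⊕ Fin 3) := Term.var (Sum.inr 1)
  let z : Lring.Term (Fin 3 ⊕ Fin 3) := Term.var (Sum.inr 2)
  ∃' ∃' ∃' (((1 + 1) + a * b * (k * k) + b * (z * z)) =' (x * x + a * (y * y)))

/-- The result of substituting the terms `a, b, k` for the free variables of `phi`, inside a
formula with one free variable and `m` quantified ones. -/
def phiAt {m : ℕ} (a b k : Lring.Term (Fin 1 ⊕ Fin m)) : Lring.BoundedFormula (Fin 1) m :=
  BoundedFormula.relabel (k := 0) id (phi.subst ![a, b, k])

/-- The formula `ψ(n) := ∀ a b ≠ 0, [{φ(a,b,0) ∧ ∀ k, (φ(a,b,k) → φ(a,b,k+1))} → φ(a,b,n)]`,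
with the only free variable `n`. -/
def psi : Lring.Formula (Fin 1) :=
  ∀' ∀' ((∼ ((&0 : Lring.Term (Fin 1 ⊕ Fin 2)) =' 0) ⊓ ∼ ((&1 : Lring.Term (Fin 1 ⊕ Fin 2)) =' 0)) ⟹
    ((phiAt (&0) (&1) 0 ⊓ ∀' (phiAt (&0) (&1) (&2) ⟹ phiAt (&0) (&1) (&2 + 1))) ⟹
      phiAt (&0) (&1) (Term.var (Sum.inl 0))))

theorem realize_add {α : Type} (t s : Lring.Term α) (v : α → ℚ) :
    (t + s).realize v = t.realize v + s.realize v := rfl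

theorem realize_mul {α : Type} (t s : Lring.Term α) (v : α → ℚ) :
    (t * s).realize v = t.realize v * s.realize v := rfl

theorem realize_zero {α : Type} (v : α → ℚ) : (0 : Lring.Term α).realize v = 0 := rfl

theorem realize_one {α : Type} (v : α → ℚ) : (1 : Lring.Term α).realize v = 1 := rfl

/-- The reading of `phi` in `ℚ`. -/
theorem realize_phi (v : Fin 3 → ℚ) :
    phi.Realize v ↔
      ∃ x y z : ℚ, 2 + v 0 * v 1 * v 2 ^ 2 + v 1 * z ^ 2 = x ^ 2 + v 0 * y ^ 2 := by
  simp only [phi, Formula.Realize, BoundedFormula.realize_ex, BoundedFormula.realize_bdEqual,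
    realize_add, realize_mul, realize_one, Term.realize_var, Sum.elim_inl, Sum.elim_inr,
    pow_two, one_add_one_eq_two]
  rfl

theorem realize_phiAt {m : ℕ} (a b k : Lring.Term (Fin 1 ⊕ Fin m)) (v : Fin 1 → ℚ)
    (xs : Fin m → ℚ) :
    (phiAt a b k).Realize v xs ↔
      phi.Realize ![a.realize (Sum.elim v xs), b.realize (Sum.elim v xs),
        k.realize (Sum.elim v xs)] := by
  rw [phiAt, BoundedFormula.realize_relabel, BoundedFormula.realize_subst, Formula.Realize]
  refine iff_of_eq (congrArg₂ _ (funext fun i => ?_) (Subsingleton.elim _ _))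
  fin_cases i <;> rfl

/-- The reading of `psi` in `ℚ`. -/
theorem realize_psi (n : ℚ) :
    psi.Realize (fun _ => n) ↔
      ∀ a b : ℚ, a ≠ 0 ∧ b ≠ 0 →
        (phi.Realize ![a, b, 0] ∧ ∀ k : ℚ, phi.Realize ![a, b, k] → phi.Realize ![a, b, k + 1]) →
        phi.Realize ![a, b, n] := by
  simp only [psi, Formula.Realize, BoundedFormula.realize_all, BoundedFormula.realize_imp,
    BoundedFormula.realize_inf, BoundedFormula.realize_not, BoundedFormula.realize_bdEqual,
    realize_phiAt, realize_add, realize_zero, realize_one, Term.realize_var, Sum.elim_inl]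
  rfl

end Formulas

section Coding

/-- The finite alphabet in which sentences are written. -/
inductive Symb : Type
  | add | mul | zero | one | eq | bot | imp | all | prime | var

/-- A numbering of the alphabet. -/
def Symb.equivFin : Symb ≃ Fin 10 where
  toFun
    | .add => 0 | .mul => 1 | .zero => 2 | .one => 3 | .eq => 4
    | .bot => 5 | .imp => 6 | .all => 7 | .prime => 8 | .var => 9
  invFun := ![.add, .mul, .zero, .one, .eq, .bot, .imp, .all, .prime, .var]
  left_inv := by rintro (_ | _) <;> rfl
  right_inv := by intro i; fin_cases i <;> rfl

instance : Primcodable Symb := Primcodable.ofEquiv (Fin 10) Symb.equivFin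

/-- The `i`-th variable, written as `i` primes followed by the letter `v`. -/
def varString (i : ℕ) : List Symb := List.replicate i Symb.prime ++ [Symb.var]

/-- The string of a term, in prefix (Polish) notation. -/
def termString {n : ℕ} : Lring.Term (Empty ⊕ Fin n) → List Symb
  | Term.var (Sum.inr i) => varString i
  | Term.func RingFn.add ts => Symb.add :: (termString (ts 0) ++ termString (ts 1))
  | Term.func RingFn.mul ts => Symb.mul :: (termString (ts 0) ++ termString (ts 1))
  | Term.func RingFn.zero _ => [Symb.zero]
  | Term.func RingFn.one _ => [Symb.one]

/-- The string of a formula without free variables other than the quantified ones numbered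
`0, …, n - 1`, in prefix notation; the next quantifier binds the variable numbered `n`. -/
def formulaString : {n : ℕ} → Lring.BoundedFormula Empty n → List Symb
  | _, BoundedFormula.falsum => [Symb.bot]
  | _, BoundedFormula.equal t s => Symb.eq :: (termString t ++ termString s)
  | _, BoundedFormula.rel R _ => Empty.elim R
  | _, BoundedFormula.imp f g => Symb.imp :: (formulaString f ++ formulaString g)
  | n, BoundedFormula.all f => Symb.all :: (varString n ++ formulaString f)

theorem varString_inj {i j : ℕ} {l l' : List Symb}
    (h : varString i ++ l = varString j ++ l') : i = j ∧ l = l' := by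
  induction i generalizing j with
  | zero => cases j <;> simp_all [varString, List.replicate_succ]
  | succ i ih =>
    cases j with
    | zero => simp [varString, List.replicate_succ] at h
    | succ j =>
      have := @ih j (by simpa [varString, List.replicate_succ] using h)
      simpa using this

theorem varString_cons (i : ℕ) :
    ∃ l, varString i = Symb.prime :: l ∨ varString i = Symb.var :: l := by
  cases i <;> simp [varString, List.replicate_succ]

theorem termString_inj {n : ℕ} (t s : Lring.Term (Empty ⊕ Fin n)) (l l' : List Symb)
    (h : termString t ++ l = termString s ++ l') : t = s ∧ l = l' := by
  induction t generalizing s l l' with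
  | var i =>
    rcases i with e | i
    · exact e.elim
    rcases s with (e | j) | ⟨g, us⟩
    · exact e.elim
    · obtain ⟨h1, h2⟩ := varString_inj (by simpa [termString] using h)
      exact ⟨by rw [Fin.ext h1], h2⟩
    · obtain ⟨r, hr⟩ := varString_cons i
      rcases hr with hr | hr <;> cases g <;> simp [termString, hr] at h
  | func f ts ih =>
    rcases s with (e | j) | ⟨g, us⟩
    · exact e.elim
    · obtain ⟨r, hr⟩ := varString_cons j
      rcases hr with hr | hr <;> cases f <;> simp [termString, hr] at h
    · cases f <;> cases g <;>
        simp only [termString, List.cons_append, List.append_assoc, List.cons.injEq,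
          reduceCtorEq, false_and, true_and, List.nil_append] at h
      · obtain ⟨h1, h2⟩ := ih 0 _ _ _ h
        obtain ⟨h3, h4⟩ := ih 1 _ _ _ h2
        exact ⟨congrArg _ (funext fun i => by fin_cases i <;> assumption), h4⟩
      · obtain ⟨h1, h2⟩ := ih 0 _ _ _ h
        obtain ⟨h3, h4⟩ := ih 1 _ _ _ h2
        exact ⟨congrArg _ (funext fun i => by fin_cases i <;> assumption), h4⟩
      · exact ⟨congrArg _ (Subsingleton.elim _ _), h⟩
      · exact ⟨congrArg _ (Subsingleton.elim _ _), h⟩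

/-- Strings determine formulas: no string is a proper initial segment of another one. -/
theorem formulaString_inj {n : ℕ} (f g : Lring.BoundedFormula Empty n) (l l' : List Symb)
    (h : formulaString f ++ l = formulaString g ++ l') : f = g ∧ l = l' := by
  induction f generalizing l l' with
  | falsum => cases g <;> simp_all [formulaString]; rename_i R _; exact R.elim
  | rel R => exact Empty.elim R
  | equal t s =>
    cases g with
    | equal t' s' =>
      simp only [formulaString, List.cons_append, List.append_assoc, List.cons.injEq,
        true_and] at h
      obtain ⟨h1, h2⟩ := termString_inj _ _ _ _ h
      obtain ⟨h3, h4⟩ := termString_inj _ _ _ _ h2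
      exact ⟨by rw [h1, h3], h4⟩
    | rel R => exact Empty.elim R
    | _ => simp [formulaString] at h
  | imp f₁ f₂ ih₁ ih₂ =>
    cases g with
    | imp g₁ g₂ =>
      simp only [formulaString, List.cons_append, List.append_assoc, List.cons.injEq,
        true_and] at h
      obtain ⟨h1, h2⟩ := ih₁ _ _ _ h
      obtain ⟨h3, h4⟩ := ih₂ _ _ _ h2
      exact ⟨by rw [h1, h3], h4⟩
    | rel R => exact Empty.elim R
    | _ => simp [formulaString] at h
  | all f ih =>
    cases g with
    | all g =>
      simp only [formulaString, List.cons_append, List.append_assoc, List.cons.injEq,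
        true_and] at h
      obtain ⟨h1, h2⟩ := ih _ _ _ (varString_inj h).2
      exact ⟨by rw [h1], h2⟩
    | rel R => exact Empty.elim R
    | _ => simp [formulaString] at h

/-- Different sentences have different strings. -/
theorem formulaString_injective :
    Function.Injective (formulaString : Lring.Sentence → List Symb) :=
  fun f g h => (formulaString_inj f g [] [] (by rw [h])).1

end Coding

/-- A set `T` of sentences is decidable if there is an algorithm (a recursive function) which, given
the string of any sentence `σ`, answers whether `σ` belongs to `T`. -/
def TheoryDecidable (T : Lring.Theory) : Prop :=
  ∃ f : List Symb → Bool, Computable f ∧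
    ∀ σ : Lring.Sentence, f (formulaString σ) = true ↔ σ ∈ T

end RingTheoryOfRat

/-! The equation in `phi` says that `k` is a coordinate of an element of norm 2 in the quaternion
algebra over ℚ with i² = -a and j² = b. For (a, b) = (1, 3), whose algebra ramifies at 2 and 3, and
for pairs of primes (q, p) chosen so that it ramifies at p and q, the formula holds exactly when
neither ramified prime divides the denominator of k (`realize_phi_one_three`, `realize_phi_prime`).
Necessity is infinite descent at a ramified prime, where the norm form has no nontrivial zero. For
sufficiency write k = u/d and M = 2d² + abu²; it is enough to find a prime l that is both of the
form Mw² + bz² with w ≠ 0 and of the form x² + ay². Dirichlet's theorem and quadratic reciprocity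
produce l, and Legendre's theorem (for a = 1, Fermat's two squares) gives the representations. Such
denominator conditions hold at 0 and survive k ↦ k + 1, so `psi` removes every prime from the
denominator of n. Conversely, induction reaches all natural numbers, and the equation sees only k².
For undecidability, `psi` and Lagrange's four squares define ℕ in ℚ. Gödel's β function then makes
the graph of every partial recursive function definable (`arithmetical_of_partrec`), and the halting
problem reduces to the theory of ℚ. -/

namespace RingTheoryOfRat

/-! ### Legendre's theorem for coprime, not necessarily squarefree, coefficients -/

/-- The congruences behind Legendre's theorem. -/
theorem dvd_form_of_residues {a b c : ℕ} (hab : a.Coprime b) (hbc : b.Coprime c)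
    (hac : a.Coprime c) {r s t x y z : ℤ} (hr : (a : ℤ) ∣ b * r ^ 2 - c)
    (hs : (b : ℤ) ∣ c * s ^ 2 - a) (ht : (c : ℤ) ∣ a * t ^ 2 + b) (hA : (a : ℤ) ∣ y - r * z)
    (hB : (b : ℤ) ∣ z - s * x) (hC : (c : ℤ) ∣ x - t * y) :
    ((a : ℤ) * b * c) ∣ a * x ^ 2 + b * y ^ 2 - c * z ^ 2 := by
  have dA : (a : ℤ) ∣ a * x ^ 2 + b * y ^ 2 - c * z ^ 2 := by
    rw [show (a : ℤ) * x ^ 2 + b * y ^ 2 - c * z ^ 2 =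
      b * (y + r * z) * (y - r * z) + (b * r ^ 2 - c) * z ^ 2 + a * x ^ 2 by ring]
    exact ((hA.mul_left _).add (hr.mul_right _)).add (dvd_mul_right _ _)
  have dB : (b : ℤ) ∣ a * x ^ 2 + b * y ^ 2 - c * z ^ 2 := by
    rw [show (a : ℤ) * x ^ 2 + b * y ^ 2 - c * z ^ 2 =
      b * y ^ 2 - c * (z + s * x) * (z - s * x) - (c * s ^ 2 - a) * x ^ 2 by ring]
    exact ((dvd_mul_right _ _).sub (hB.mul_left _)).sub (hs.mul_right _)
  have dC : (c : ℤ) ∣ a * x ^ 2 + b * y ^ 2 - c * z ^ 2 := by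
    rw [show (a : ℤ) * x ^ 2 + b * y ^ 2 - c * z ^ 2 =
      a * (x + t * y) * (x - t * y) + (a * t ^ 2 + b) * y ^ 2 - c * z ^ 2 by ring]
    exact ((hC.mul_left _).add (ht.mul_right _)).sub (dvd_mul_right _ _)
  refine IsCoprime.mul_dvd ?_ (IsCoprime.mul_dvd ?_ dA dB) dC
  · exact IsCoprime.mul_left (Nat.isCoprime_iff_coprime.2 hac) (Nat.isCoprime_iff_coprime.2 hbc)
  · exact Nat.isCoprime_iff_coprime.2 hab

/-- A small nonzero value of `a x² + b y² - c z²` divisible by `abc` yields a zero, by Mordell's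
identity. -/
theorem exists_int_sol_of_small {a b c : ℤ} (ha : 0 < a) (hb : 0 < b) (hc : 0 < c) {x y z : ℤ}
    (bx : x ^ 2 < b * c) (hy : y ^ 2 ≤ a * c) (bz : z ^ 2 < a * b)
    (h0 : ¬ (x = 0 ∧ y = 0 ∧ z = 0)) (hd : a * b * c ∣ a * x ^ 2 + b * y ^ 2 - c * z ^ 2) :
    ∃ x y z : ℤ, z ≠ 0 ∧ a * x ^ 2 + b * y ^ 2 = c * z ^ 2 := by
  obtain ⟨k, hk⟩ := hd
  have habc : 0 < a * b * c := by positivity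
  have px := mul_nonneg ha.le (sq_nonneg x)
  have py := mul_nonneg hb.le (sq_nonneg y)
  have pz := mul_nonneg hc.le (sq_nonneg z)
  have k1 : k < 2 := by
    refine lt_of_mul_lt_mul_left (a := a * b * c) ?_ habc.le
    linarith [mul_lt_mul_of_pos_left bx ha, mul_le_mul_of_nonneg_left hy hb.le]
  have k2 : -1 < k := by
    refine lt_of_mul_lt_mul_left (a := a * b * c) ?_ habc.le
    linarith [mul_lt_mul_of_pos_left bz hc]
  obtain rfl | rfl : k = 0 ∨ k = 1 := by omega
  · refine ⟨x, y, z, ?_, by linarith⟩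
    rintro rfl
    have e1 : a * x ^ 2 = 0 := by linarith
    have e2 : b * y ^ 2 = 0 := by linarith
    exact h0 ⟨by simpa [ha.ne'] using e1, by simpa [hb.ne'] using e2, rfl⟩
  -- Here ax² + by² = c(z² + ab), while a(xz + by)² + b(yz - ax)² = (ax² + by²)(z² + ab).
  · refine ⟨x * z + b * y, y * z - a * x, z ^ 2 + a * b, by positivity, ?_⟩
    linear_combination (z ^ 2 + a * b) * hk

/-- Legendre's theorem on `a x² + b y² = c z²`, by the box principle and Mordell's identity. -/
theorem exists_int_sol_of_residues {a b c : ℕ} (ha : 0 < a) (hb : 0 < b) (hc : 0 < c)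
    (hab : a.Coprime b) (hbc : b.Coprime c) (hac : a.Coprime c)
    (nab : ¬ IsSquare (a * b)) (nbc : ¬ IsSquare (b * c)) (r s t : ℤ)
    (hr : (a : ℤ) ∣ b * r ^ 2 - c) (hs : (b : ℤ) ∣ c * s ^ 2 - a) (ht : (c : ℤ) ∣ a * t ^ 2 + b) :
    ∃ x y z : ℤ, z ≠ 0 ∧ a * x ^ 2 + b * y ^ 2 = c * z ^ 2 := by
  have : NeZero a := ⟨ha.ne'⟩
  have : NeZero b := ⟨hb.ne'⟩
  have : NeZero c := ⟨hc.ne'⟩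
  let box : Finset (ℕ × ℕ × ℕ) := Finset.range (Nat.sqrt (b * c) + 1) ×ˢ
    (Finset.range (Nat.sqrt (a * c) + 1) ×ˢ Finset.range (Nat.sqrt (a * b) + 1))
  let F : ℕ × ℕ × ℕ → ZMod a × ZMod b × ZMod c := fun v =>
    (((v.2.1 - r * v.2.2 : ℤ) : ZMod a), ((v.2.2 - s * v.1 : ℤ) : ZMod b),
      ((v.1 - t * v.2.1 : ℤ) : ZMod c))
  have hcard : (Finset.univ : Finset (ZMod a × ZMod b × ZMod c)).card < box.card := by
    simp only [box, Finset.card_product, Finset.card_range, Finset.card_univ, Fintype.card_prod,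
      ZMod.card]
    have h1 := Nat.lt_succ_sqrt (b * c)
    have h2 := Nat.lt_succ_sqrt (a * c)
    have h3 := Nat.lt_succ_sqrt (a * b)
    simp only [Nat.succ_eq_add_one] at h1 h2 h3
    -- Squaring removes the roots: the sides of the box exceed √(bc), √(ac), √(ab), whose product is
    -- abc.
    refine lt_of_pow_lt_pow_left₀ 2 (Nat.zero_le _) ?_
    calc (a * (b * c)) ^ 2 = (b * c) * ((a * c) * (a * b)) := by ring
      _ < (((b * c).sqrt + 1) * ((b * c).sqrt + 1)) *
          ((((a * c).sqrt + 1) * ((a * c).sqrt + 1)) *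
            (((a * b).sqrt + 1) * ((a * b).sqrt + 1))) := by gcongr
      _ = _ := by ring
  obtain ⟨⟨x₁, y₁, z₁⟩, h₁, ⟨x₂, y₂, z₂⟩, h₂, hne, hF⟩ :=
    Finset.exists_ne_map_eq_of_card_lt_of_maps_to (f := F) hcard
      (fun _ _ => Finset.mem_coe.2 (Finset.mem_univ _))
  simp only [box, Finset.mem_product, Finset.mem_range, Nat.lt_succ_iff] at h₁ h₂
  simp only [F, Prod.mk.injEq, ZMod.intCast_eq_intCast_iff_dvd_sub] at hF
  obtain ⟨hA, hB, hC⟩ := hF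
  have bound : ∀ {m u v : ℕ}, u ≤ m.sqrt → v ≤ m.sqrt → ((v : ℤ) - u) ^ 2 ≤ m := by
    intro m u v hu hv
    have h := Nat.sqrt_le m
    zify at h hu hv
    have : |(v : ℤ) - u| ≤ |(m.sqrt : ℤ)| := by
      rw [abs_of_nonneg (a := (m.sqrt : ℤ)) (by positivity)]
      exact abs_le.2 ⟨by linarith [Int.natCast_nonneg v], by linarith [Int.natCast_nonneg u]⟩
    nlinarith [sq_le_sq.2 this]
  obtain ⟨x, hx⟩ : ∃ x : ℤ, x = x₂ - x₁ := ⟨_, rfl⟩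
  obtain ⟨y, hy⟩ : ∃ y : ℤ, y = y₂ - y₁ := ⟨_, rfl⟩
  obtain ⟨z, hz⟩ : ∃ z : ℤ, z = z₂ - z₁ := ⟨_, rfl⟩
  have bx : x ^ 2 ≤ ((b * c : ℕ) : ℤ) := hx ▸ bound h₁.1 h₂.1
  have bY : y ^ 2 ≤ ((a * c : ℕ) : ℤ) := hy ▸ bound h₁.2.1 h₂.2.1
  have bz : z ^ 2 ≤ ((a * b : ℕ) : ℤ) := hz ▸ bound h₁.2.2 h₂.2.2
  -- Strict bounds on x² and z² keep the quotient by abc strictly between -1 and 2; the bound on y²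
  -- may be an equality.
  have nonsq : ∀ {m : ℕ} {w : ℤ}, ¬ IsSquare m → w ^ 2 ≤ (m : ℤ) → w ^ 2 < (m : ℤ) := by
    intro m w hm hw
    refine lt_of_le_of_ne hw fun h => hm ⟨w.natAbs, ?_⟩
    zify
    rw [← h, pow_two, abs_mul_abs_self]
  have bx' := nonsq nbc bx
  have bz' := nonsq nab bz
  push_cast at bx' bY bz'
  have h0 : ¬ (x = 0 ∧ y = 0 ∧ z = 0) := by
    rintro ⟨h, h', h''⟩
    apply hne
    simp only [Prod.mk.injEq]
    omega
  have ha' : (0 : ℤ) < a := by exact_mod_cast ha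
  have hb' : (0 : ℤ) < b := by exact_mod_cast hb
  have hc' : (0 : ℤ) < c := by exact_mod_cast hc
  have hA' : (a : ℤ) ∣ y - r * z := by rw [hy, hz]; convert hA using 1; ring
  have hB' : (b : ℤ) ∣ z - s * x := by rw [hx, hz]; convert hB using 1; ring
  have hC' : (c : ℤ) ∣ x - t * y := by rw [hx, hy]; convert hC using 1; ring
  exact exists_int_sol_of_small ha' hb' hc' bx' bY bz' h0
    (dvd_form_of_residues hab hbc hac hr hs ht hA' hB' hC')

/-! ### Reciprocity, Dirichlet's theorem and primes represented by binary forms -/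

/-- Iterated, this gathers several residue conditions into one class prime to the modulus, as
Dirichlet's theorem requires. -/
theorem exists_coprime_modEq {m n a b : ℕ} (h : m.Coprime n) (ha : a.Coprime m)
    (hb : b.Coprime n) : ∃ k, k.Coprime (m * n) ∧ k ≡ a [MOD m] ∧ k ≡ b [MOD n] := by
  obtain ⟨k, h1, h2⟩ := Nat.chineseRemainder h a b
  refine ⟨k, Nat.Coprime.mul_right ?_ ?_, h1, h2⟩
  · rw [Nat.Coprime, h1.gcd_eq]; exact ha
  · rw [Nat.Coprime, h2.gcd_eq]; exact hb

theorem jacobiSym_natCast_eq_of_modEq {a b n : ℕ} (h : a ≡ b [MOD n]) :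
    jacobiSym a n = jacobiSym b n :=
  jacobiSym.mod_left' (by exact_mod_cast h)

/-- Divide a square root of -Mp modulo l by M. This is Legendre's condition at the coefficient l. -/
theorem exists_dvd_sq_mul_add {l M p : ℕ} (hl : l.Prime) (hM : M.Coprime l)
    (h : jacobiSym (-(M * p)) l = 1) : ∃ t : ℤ, (l : ℤ) ∣ M * t ^ 2 + p := by
  have := Fact.mk hl
  obtain ⟨u, hu⟩ := ZMod.isSquare_of_jacobiSym_eq_one h
  have hM0 : (M : ZMod l) ≠ 0 := fun h0 => by
    rw [ZMod.natCast_eq_zero_iff] at h0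
    exact hl.one_lt.ne' (Nat.dvd_one.1 (hM ▸ Nat.dvd_gcd h0 dvd_rfl))
  obtain ⟨t, ht⟩ := ZMod.intCast_surjective (u / (M : ZMod l))
  refine ⟨t, (ZMod.intCast_zmod_eq_zero_iff_dvd _ _).1 ?_⟩
  push_cast at hu ⊢
  rw [ht]
  field_simp
  linear_combination -hu

/-- Quadratic reciprocity provides a residue modulo `8` for which `-Mp` is a square modulo the
primes `l` with `l ≡ p` modulo the odd part of `M` and `l ≡ M` modulo `p`. -/
theorem exists_residue_jacobiSym {M₁ e p : ℕ} (hp2 : p % 2 = 1) (hM : M₁ % 2 = 1)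
    (he : e = 1 ∨ e = 2) (hpM : p.Coprime (e * M₁)) :
    ∃ c : ℕ, (c = 1 ∨ c = 5 ∨ c = 3 ∧ p % 4 = 3 ∧ e * M₁ % 4 = 3) ∧
      ∀ l : ℕ, l.Prime → l ≡ c [MOD 8] → l ≡ p [MOD M₁] → l ≡ e * M₁ [MOD p] →
        jacobiSym (-((e * M₁ : ℕ) * p)) l = 1 := by
  have hpo : Odd p := Nat.odd_iff.2 hp2
  have hMo : Odd M₁ := Nat.odd_iff.2 hM
  have key : ∀ l : ℕ, l ≡ p [MOD M₁] → l ≡ e * M₁ [MOD p] → l % 4 = 1 →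
      jacobiSym (-((e * M₁ : ℕ) * p)) l =
        jacobiSym e l * (jacobiSym p M₁ * jacobiSym (e * M₁ : ℕ) p) := by
    intro l h1 h2 h4
    have hlo : Odd l := Nat.odd_iff.2 (by omega)
    rw [jacobiSym.neg _ hlo, ZMod.χ₄_nat_one_mod_four h4, one_mul, jacobiSym.mul_left,
      jacobiSym.quadratic_reciprocity_one_mod_four' hpo h4, jacobiSym_natCast_eq_of_modEq h2]
    conv_lhs => rw [Nat.cast_mul, jacobiSym.mul_left,
      jacobiSym.quadratic_reciprocity_one_mod_four' hMo h4, jacobiSym_natCast_eq_of_modEq h1]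
    push_cast
    ring
  have hg : Int.gcd ((e * M₁ : ℕ) : ℤ) p = 1 := by
    rw [Int.gcd_natCast_natCast]; exact hpM.symm
  have hg' : Int.gcd (p : ℤ) M₁ = 1 := by
    rw [Int.gcd_natCast_natCast]; exact hpM.coprime_mul_left_right
  rcases he with rfl | rfl
  · have hsq := jacobiSym.sq_one hg
    simp only [one_mul] at hsq key ⊢
    by_cases h4 : p % 4 = 3 ∧ M₁ % 4 = 3
    · refine ⟨3, by simp [h4], fun l _ h8 h1 h2 => ?_⟩
      have hl4 : l % 4 = 3 := by have : l % 8 = 3 := h8; omega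
      have hlo : Odd l := Nat.odd_iff.2 (by omega)
      rw [jacobiSym.neg _ hlo, ZMod.χ₄_nat_three_mod_four hl4, jacobiSym.mul_left,
        jacobiSym.quadratic_reciprocity_three_mod_four h4.1 hl4,
        jacobiSym.quadratic_reciprocity_three_mod_four h4.2 hl4, jacobiSym_natCast_eq_of_modEq h2,
        jacobiSym_natCast_eq_of_modEq h1, jacobiSym.quadratic_reciprocity_three_mod_four h4.1 h4.2]
      linear_combination hsq
    · refine ⟨1, by simp, fun l _ h8 h1 h2 => ?_⟩
      have hl4 : l % 4 = 1 := by have : l % 8 = 1 := h8; omega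
      rw [key l h1 h2 hl4]
      have : jacobiSym p M₁ = jacobiSym M₁ p := by
        rcases Nat.odd_mod_four_iff.1 hp2 with h | h
        · exact jacobiSym.quadratic_reciprocity_one_mod_four h hMo
        · exact jacobiSym.quadratic_reciprocity_one_mod_four' hpo (by omega)
      rw [this, Nat.cast_one, jacobiSym.one_left]
      linear_combination hsq
  · have h5 : ∀ l : ℕ, l % 2 = 1 → jacobiSym ((2 : ℕ) : ℤ) l =
        if l % 8 = 1 ∨ l % 8 = 7 then 1 else -1 := by
      intro l hl
      rw [Nat.cast_ofNat, jacobiSym.at_two (Nat.odd_iff.2 hl), ZMod.χ₈_nat_eq_if_mod_eight]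
      simp [hl]
    rcases jacobiSym.eq_one_or_neg_one hg with h | h <;>
    rcases jacobiSym.eq_one_or_neg_one hg' with h' | h'
    on_goal 1 => refine ⟨1, by simp, fun l _ h8 h1 h2 => ?_⟩
    on_goal 2 => refine ⟨5, by simp, fun l _ h8 h1 h2 => ?_⟩
    on_goal 3 => refine ⟨5, by simp, fun l _ h8 h1 h2 => ?_⟩
    on_goal 4 => refine ⟨1, by simp, fun l _ h8 h1 h2 => ?_⟩
    all_goals
      have h8' : l % 8 = _ := h8
      rw [key l h1 h2 (by omega), h, h', h5 l (by omega)]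
      simp [h8']

/-- The prime p occurs exactly once in Mp. This feeds the strict bounds of the box argument. -/
theorem not_isSquare_mul_prime {p M : ℕ} (hp : p.Prime) (h : M.Coprime p) :
    ¬ IsSquare (M * p) := by
  rintro ⟨w, hw⟩
  have h1 : p ∣ w := by
    have : p ∣ w * w := hw ▸ dvd_mul_left _ _
    exact (hp.dvd_mul.1 this).elim id id
  obtain ⟨v, rfl⟩ := h1
  have h2 : M = p * (v * v) := by
    apply Nat.eq_of_mul_eq_mul_right hp.pos; rw [hw]; ring
  exact hp.one_lt.ne' (Nat.dvd_one.1 (h ▸ Nat.dvd_gcd ⟨_, h2⟩ dvd_rfl))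

/-- A prime `l` that is represented by `M w² + p z²` and lies in the residue class `1` modulo
`N`. -/
theorem exists_prime_eq_binary {M p N : ℕ} (hp : p.Prime) (hp2 : p % 2 = 1) (hM : M % 4 ≠ 0)
    (hpM : M.Coprime p) (hN2 : N % 2 = 1) (hNM : M.Coprime N) (hNp : p.Coprime N) :
    ∃ l : ℕ, l.Prime ∧ N < l ∧ l ≡ 1 [MOD N] ∧ (l % 4 = 1 ∨ l % 4 = 3 ∧ M % 4 = 3) ∧
      ∃ w z : ℚ, w ≠ 0 ∧ (l : ℚ) = M * w ^ 2 + p * z ^ 2 := by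
  obtain ⟨e, M₁, he, hM₁, rfl⟩ : ∃ e M₁, (e = 1 ∨ e = 2) ∧ M₁ % 2 = 1 ∧ M = e * M₁ := by
    rcases Nat.mod_two_eq_zero_or_one M with h | h
    · exact ⟨2, M / 2, by simp, by omega, by omega⟩
    · exact ⟨1, M, by simp, h, by simp⟩
  obtain ⟨c, hc, hJ⟩ := exists_residue_jacobiSym hp2 hM₁ he hpM.symm
  have h8 : ∀ {m : ℕ}, m % 2 = 1 → Nat.Coprime 8 m := fun {m} h =>
    Nat.Coprime.pow_left 3 ((Nat.coprime_two_left).2 (Nat.odd_iff.2 h))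
  have hM₁p : M₁.Coprime p := hpM.coprime_mul_left
  have hM₁N : M₁.Coprime N := hNM.coprime_mul_left
  -- The class of l is c modulo 8, p modulo M₁, M modulo p and 1 modulo N. The first two make l ≡ p
  -- modulo M and the third l ≡ M modulo p, so two of Legendre's conditions hold with root 1.
  obtain ⟨k₁, hk₁, h11, h12⟩ := exists_coprime_modEq (a := c) (b := p) (h8 hM₁)
    (by rcases hc with rfl | rfl | ⟨rfl, -⟩ <;> decide) hM₁p.symm
  obtain ⟨k₂, hk₂, h21, h22⟩ := exists_coprime_modEq (a := k₁) (b := e * M₁)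
    ((h8 hp2).mul_left hM₁p) hk₁ hpM
  obtain ⟨k₃, hk₃, h31, h32⟩ := exists_coprime_modEq (a := k₂) (b := 1) (n := N)
    (((h8 hN2).mul_left hM₁N).mul_left hNp) hk₂ (Nat.coprime_one_left _)
  have hM0 : 0 < M₁ := by omega
  have hN0 : 0 < N := by omega
  have he0 : 0 < e := by omega
  obtain ⟨l, hl, hlp, hlk⟩ := Nat.forall_exists_prime_gt_and_modEq (N + e * M₁ + p)
    (q := 8 * M₁ * p * N) (a := k₃) (mul_pos (mul_pos (by omega) hp.pos) hN0).ne' hk₃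
  have m2 : l ≡ k₂ [MOD 8 * M₁ * p] := (hlk.of_mul_right N).trans h31
  have m1 : l ≡ k₁ [MOD 8 * M₁] := (m2.of_mul_right p).trans h21
  have l8 : l ≡ c [MOD 8] := (m1.of_mul_right _).trans h11
  have lM : l ≡ p [MOD M₁] := (m1.of_mul_left _).trans h12
  have lp : l ≡ e * M₁ [MOD p] := (m2.of_mul_left _).trans h22
  have lN : l ≡ 1 [MOD N] := (hlk.of_mul_left _).trans h32
  have cop : ∀ {m : ℕ}, 0 < m → m < l → m.Coprime l := fun h0 h =>
    ((Nat.Prime.coprime_iff_not_dvd hlp).2 (Nat.not_dvd_of_pos_of_lt h0 h)).symm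
  have hMl : (e * M₁).Coprime l := cop (by positivity) (by omega)
  have hpl : p.Coprime l := cop hp.pos (by omega)
  obtain ⟨t, ht⟩ := exists_dvd_sq_mul_add hlp hMl (hJ l hlp l8 lM lp)
  have l8' : l % 8 = c % 8 := l8
  have hr : ((e * M₁ : ℕ) : ℤ) ∣ p * 1 ^ 2 - l := by
    have h1 : (M₁ : ℤ) ∣ p - l := Nat.modEq_iff_dvd.1 lM
    rcases he with rfl | rfl
    · simpa using h1
    · have h2 : (2 : ℤ) ∣ p - l := by omega
      have := IsCoprime.mul_dvd (by
        exact_mod_cast Nat.isCoprime_iff_coprime.2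
          (Nat.coprime_two_left.2 (Nat.odd_iff.2 hM₁))) h2 h1
      simpa using this
  have hs : (p : ℤ) ∣ l * 1 ^ 2 - (e * M₁ : ℕ) := by
    simpa using Nat.modEq_iff_dvd.1 lp.symm
  obtain ⟨x, y, z, hz, h⟩ := exists_int_sol_of_residues (by positivity) hp.pos hlp.pos hpM hpl hMl
    (not_isSquare_mul_prime hp hpM) (not_isSquare_mul_prime hlp hpl) 1 1 t hr hs ht
  have hz' : (z : ℚ) ≠ 0 := by exact_mod_cast hz
  have h' : ((e * M₁ : ℕ) : ℚ) * (x : ℚ) ^ 2 + p * (y : ℚ) ^ 2 = l * (z : ℚ) ^ 2 := by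
    exact_mod_cast h
  refine ⟨l, hlp, by omega, lN, ?_, x / z, y / z, ?_, ?_⟩
  · rcases hc with rfl | rfl | ⟨rfl, -, h⟩ <;> omega
  -- If x = 0, then pl is the square of py/z, although p and l are distinct primes.
  · refine div_ne_zero (fun hx => ?_) hz'
    have hx' : x = 0 := by exact_mod_cast hx
    subst hx'
    refine not_isSquare_mul_prime hlp hpl ?_
    have h1 : ((p * l : ℕ) : ℚ) = (p * y / z) * (p * y / z) := by
      push_cast
      field_simp
      linear_combination -(p : ℚ) * h'
    have : IsSquare ((p * l : ℕ) : ℚ) := ⟨_, h1⟩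
    exact Rat.isSquare_natCast_iff.1 this
  · field_simp
    linear_combination -h'

/-- A prime `l ≡ 1` modulo the prime `q ≡ 3` modulo `4` is represented by `x² + q y²`. -/
theorem exists_eq_sq_add_mul_sq {l q : ℕ} (hl : l.Prime) (hq : q.Prime) (hql : q < l)
    (h4 : q % 4 = 3) (h1 : l ≡ 1 [MOD q]) :
    ∃ x y : ℚ, (l : ℚ) = x ^ 2 + q * y ^ 2 := by
  have hqo : Odd q := Nat.odd_iff.2 (by omega)
  have hlo : l % 2 = 1 := hl.eq_two_or_odd.resolve_left (by omega)
  have hc : q.Coprime l := (Nat.coprime_primes hq hl).2 hql.ne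
  have hJ : jacobiSym (-((1 : ℕ) * q)) l = 1 := by
    rw [Nat.cast_one, one_mul, jacobiSym.neg _ (Nat.odd_iff.2 hlo)]
    have h1' : jacobiSym l q = 1 := by
      rw [jacobiSym_natCast_eq_of_modEq h1, Nat.cast_one, jacobiSym.one_left]
    rcases Nat.odd_mod_four_iff.1 hlo with h | h
    · rw [ZMod.χ₄_nat_one_mod_four h, jacobiSym.quadratic_reciprocity_one_mod_four' hqo h, h1',
        one_mul]
    · rw [ZMod.χ₄_nat_three_mod_four h, jacobiSym.quadratic_reciprocity_three_mod_four h4 h, h1']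
      rfl
  obtain ⟨t, ht⟩ := exists_dvd_sq_mul_add hl (Nat.coprime_one_left _) hJ
  obtain ⟨x, y, z, hz, h⟩ := exists_int_sol_of_residues one_pos hq.pos hl.pos
    (Nat.coprime_one_left _) hc (Nat.coprime_one_left _)
    (not_isSquare_mul_prime hq (Nat.coprime_one_left _)) (not_isSquare_mul_prime hl hc) 1 1 t
    (by simp) (by simpa using Nat.modEq_iff_dvd.1 h1.symm) ht
  have hz' : (z : ℚ) ≠ 0 := by exact_mod_cast hz
  have h' : (x : ℚ) ^ 2 + q * (y : ℚ) ^ 2 = l * (z : ℚ) ^ 2 := by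
    exact_mod_cast (by simpa using h)
  refine ⟨x / z, y / z, ?_⟩
  field_simp
  linear_combination -h'

/-! ### Necessity: descent at the ramified primes -/

/-- Infinite descent: if `r ∣ D` makes all the variables of the homogeneous equation divisible by
`r`, then `r` does not divide the denominator of `k`. -/
theorem not_dvd_den_of_descent {r : ℕ} (hr : 1 < r) {a b : ℤ}
    (h : ∀ X Y Z K D : ℤ, X ^ 2 + a * Y ^ 2 = 2 * D ^ 2 + a * b * K ^ 2 + b * Z ^ 2 →
      (r : ℤ) ∣ D → (r : ℤ) ∣ X ∧ (r : ℤ) ∣ Y ∧ (r : ℤ) ∣ Z ∧ (r : ℤ) ∣ K)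
    {x y z k : ℚ} (he : 2 + a * b * k ^ 2 + b * z ^ 2 = x ^ 2 + a * y ^ 2) : ¬ r ∣ k.den := by
  -- D is any common denominator; once r does not divide it, the denominator of K/D, a divisor of D,
  -- is free of r too.
  have key : ∀ D : ℕ, 0 < D → ∀ X Y Z K : ℤ,
      X ^ 2 + a * Y ^ 2 = 2 * (D : ℤ) ^ 2 + a * b * K ^ 2 + b * Z ^ 2 →
      ¬ r ∣ ((K : ℚ) / ((D : ℤ) : ℚ)).den := by
    intro D
    induction D using Nat.strong_induction_on with
    | _ D ih =>
      intro hD X Y Z K e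
      by_cases hrD : r ∣ D
      · obtain ⟨⟨X', rfl⟩, ⟨Y', rfl⟩, ⟨Z', rfl⟩, ⟨K', rfl⟩⟩ :=
          h X Y Z K D e (Int.natCast_dvd_natCast.2 hrD)
        obtain ⟨D', rfl⟩ := hrD
        have hD' : 0 < D' := Nat.pos_of_mul_pos_left hD
        have hr0 : (r : ℤ) ≠ 0 := by omega
        have e' : X' ^ 2 + a * Y' ^ 2 = 2 * (D' : ℤ) ^ 2 + a * b * K' ^ 2 + b * Z' ^ 2 := by
          apply mul_left_cancel₀ (pow_ne_zero 2 hr0)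
          push_cast at e
          linear_combination e
        have := ih D' (by nlinarith) hD' X' Y' Z' K' e'
        have hrq : (r : ℚ) ≠ 0 := by exact_mod_cast hr0
        push_cast
        rw [mul_div_mul_left _ _ hrq]
        exact_mod_cast this
      · intro hdvd
        apply hrD
        have := Rat.den_dvd K D
        rw [Rat.divInt_eq_div] at this
        exact hdvd.trans (Int.natCast_dvd_natCast.1 this)
  have := key (x.den * y.den * z.den * k.den) (by positivity)
    (x.num * (y.den * z.den * k.den)) (y.num * (x.den * z.den * k.den))
    (z.num * (x.den * y.den * k.den)) (k.num * (x.den * y.den * z.den)) (by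
      qify
      rw [← Rat.mul_den_eq_num x, ← Rat.mul_den_eq_num y, ← Rat.mul_den_eq_num z,
        ← Rat.mul_den_eq_num k]
      linear_combination -((x.den : ℚ) * y.den * z.den * k.den) ^ 2 * he)
  convert this using 3
  push_cast
  have hk := Rat.num_div_den k
  conv_lhs => rw [← hk]
  field_simp

/-- Descent at a prime `r` with `b = ± r` for which `-a` is not a square modulo `r`. -/
theorem not_dvd_den_of_jacobiSym {r : ℕ} (hr : r.Prime) {a b : ℤ} (hb : b = r ∨ b = -r)
    (hJ : jacobiSym (-a) r = -1) {x y z k : ℚ}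
    (he : 2 + a * b * k ^ 2 + b * z ^ 2 = x ^ 2 + a * y ^ 2) : ¬ r ∣ k.den := by
  have := Fact.mk hr
  refine not_dvd_den_of_descent hr.one_lt (fun X Y Z K D e hD => ?_) he
  have hrb : (r : ℤ) ∣ b := by rcases hb with rfl | rfl <;> simp
  have hXY : (r : ℤ) ∣ X ^ 2 - -a * Y ^ 2 := by
    rw [show X ^ 2 - -a * Y ^ 2 = 2 * D * D + b * (a * K ^ 2 + Z ^ 2) by linear_combination e]
    exact (hD.mul_left _).add (hrb.mul_right _)
  obtain ⟨hX, hY⟩ := jacobiSym.prime_dvd_of_eq_neg_one hJ hXY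
  -- As r divides D, X and Y, the equation holds modulo r² without their squares; b = ±r absorbs one
  -- factor r, leaving the same form in Z and K.
  have hb' : (r : ℤ) * r ∣ r * (Z ^ 2 - -a * K ^ 2) := by
    have h1 : (r : ℤ) * r ∣ b * (Z ^ 2 - -a * K ^ 2) := by
      rw [show b * (Z ^ 2 - -a * K ^ 2) = X * X + a * (Y * Y) - 2 * (D * D) by
        linear_combination -e]
      exact ((mul_dvd_mul hX hX).add ((mul_dvd_mul hY hY).mul_left _)).sub
        ((mul_dvd_mul hD hD).mul_left _)
    rcases hb with rfl | rfl
    · exact h1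
    · rw [neg_mul] at h1
      exact (dvd_neg.1 h1)
  have hr0 : (r : ℤ) ≠ 0 := by exact_mod_cast hr.ne_zero
  obtain ⟨hZ, hK⟩ := jacobiSym.prime_dvd_of_eq_neg_one hJ ((mul_dvd_mul_iff_left hr0).1 hb')
  exact ⟨hX, hY, hZ, hK⟩

/-- For even D the equation reads X² + Y² ≡ 3(Z² + K²) modulo 8. Modulo 4 the four variables have
equal parity, and all odd would give 2 ≡ 6. -/
theorem not_two_dvd_den {x y z k : ℚ} (he : 2 + 1 * 3 * k ^ 2 + 3 * z ^ 2 = x ^ 2 + 1 * y ^ 2) :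
    ¬ 2 ∣ k.den := by
  refine not_dvd_den_of_descent (a := 1) (b := 3) one_lt_two (fun X Y Z K D e hD => ?_)
    (by exact_mod_cast he)
  obtain ⟨D', rfl⟩ := hD
  have sq : ∀ t : ℤ, t % 2 = 0 ∧ t ^ 2 % 4 = 0 ∨ t % 2 = 1 ∧ t ^ 2 % 8 = 1 := by
    intro t
    rcases Int.even_or_odd' t with ⟨s, rfl | rfl⟩
    · left
      refine ⟨by omega, ?_⟩
      rw [mul_pow]; omega
    · right
      refine ⟨by omega, ?_⟩
      obtain ⟨c, hc⟩ := Int.even_mul_succ_self s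
      rw [show (2 * s + 1) ^ 2 = 4 * (s * (s + 1)) + 1 by ring, hc]
      omega
  rw [mul_pow] at e
  push_cast
  generalize D' ^ 2 = d at e
  rcases sq X with ⟨h1, h2⟩ | ⟨h1, h2⟩ <;> rcases sq Y with ⟨h3, h4⟩ | ⟨h3, h4⟩ <;>
    rcases sq Z with ⟨h5, h6⟩ | ⟨h5, h6⟩ <;> rcases sq K with ⟨h7, h8⟩ | ⟨h7, h8⟩ <;> omega

/-! ### Sufficiency and the exact denominator conditions -/

/-- Equate the two values of l and divide by (wd)², where d is the denominator of k. -/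
theorem exists_sol_of_eq_binary {a b : ℕ} {k w z x y l : ℚ} {M : ℕ} (hw : w ≠ 0)
    (hM : (M : ℚ) = 2 * k.den ^ 2 + a * b * k.num ^ 2) (h1 : l = M * w ^ 2 + b * z ^ 2)
    (h2 : l = x ^ 2 + a * y ^ 2) :
    ∃ x y z : ℚ, 2 + a * b * k ^ 2 + b * z ^ 2 = x ^ 2 + a * y ^ 2 := by
  have hd : (k.den : ℚ) ≠ 0 := by exact_mod_cast k.den_ne_zero
  refine ⟨x / (w * k.den), y / (w * k.den), z / (w * k.den), ?_⟩
  rw [hM] at h1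
  have hk : k = k.num / k.den := (Rat.num_div_den k).symm
  rw [show k ^ 2 = (k.num / k.den : ℚ) ^ 2 by rw [← hk]]
  field_simp
  linear_combination h2 - h1

/-- Since r divides ab, a common factor r would divide 2d². Here the denominator condition enters
the existence proof. -/
theorem coprime_two_mul_add {r d u a b : ℕ} (hr : r.Prime) (hr2 : r % 2 = 1) (hd : ¬ r ∣ d)
    (h : r ∣ a * b) : (2 * d ^ 2 + a * b * u ^ 2).Coprime r := by
  refine ((Nat.Prime.coprime_iff_not_dvd hr).2 fun hdvd => ?_).symm
  have h1 := (Nat.dvd_add_left (h.mul_right (u ^ 2))).1 hdvd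
  rcases hr.dvd_mul.1 h1 with h2 | h2
  · have := (Nat.prime_dvd_prime_iff_eq hr Nat.prime_two).1 h2
    omega
  · exact hd (hr.dvd_of_dvd_pow h2)

/-- As d and u are not both even, the value modulo 4 is 2 or odd. So M has at most one factor 2,
which the reciprocity argument needs. -/
theorem two_mul_add_mod_four {d u c : ℕ} (hdu : u.Coprime d) (hc : c % 2 = 1) :
    (2 * d ^ 2 + c * u ^ 2) % 4 ≠ 0 := by
  have hsq : ∀ n : ℕ, n % 2 = 0 ∧ n ^ 2 % 4 = 0 ∨ n % 2 = 1 ∧ n ^ 2 % 4 = 1 := by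
    intro n
    rcases Nat.even_or_odd' n with ⟨s, rfl | rfl⟩
    · left; refine ⟨by omega, by rw [mul_pow]; omega⟩
    · right; refine ⟨by omega, ?_⟩
      rw [show (2 * s + 1) ^ 2 = 4 * (s * (s + 1)) + 1 by ring]; omega
  have h2 : ¬ (u % 2 = 0 ∧ d % 2 = 0) := fun ⟨h1, h2⟩ => by
    have := Nat.dvd_gcd (Nat.dvd_of_mod_eq_zero h1) (Nat.dvd_of_mod_eq_zero h2)
    rw [hdu] at this
    omega
  rw [Nat.add_mod, Nat.mul_mod 2, Nat.mul_mod c]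
  have : c % 4 = 1 ∨ c % 4 = 3 := by omega
  rcases hsq d with ⟨h3, h4⟩ | ⟨h3, h4⟩ <;> rcases hsq u with ⟨h5, h6⟩ | ⟨h5, h6⟩ <;>
    rcases this with h | h <;> simp only [h4, h6, h] <;> omega

theorem natCast_two_mul_add (a b : ℕ) (k : ℚ) :
    ((2 * k.den ^ 2 + a * b * k.num.natAbs ^ 2 : ℕ) : ℚ) =
      2 * k.den ^ 2 + a * b * k.num ^ 2 := by
  push_cast
  rw [← sq_abs (k.num : ℚ)]
  simp

theorem realize_phi_one_three (k : ℚ) :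
    phi.Realize ![1, 3, k] ↔ ¬ 2 ∣ k.den ∧ ¬ 3 ∣ k.den := by
  rw [realize_phi]
  constructor
  · rintro ⟨x, y, z, h⟩
    simp only [Matrix.cons_val] at h
    refine ⟨not_two_dvd_den h, not_dvd_den_of_jacobiSym (a := 1) (b := 3) Nat.prime_three
      (by simp) ?_ (x := x) (y := y) (z := z) (by exact_mod_cast h)⟩
    rw [jacobiSym.at_neg_one (by decide)]
    rfl
  · rintro ⟨h2, h3⟩
    have hM := natCast_two_mul_add 1 3 k
    have hcop := coprime_two_mul_add (u := k.num.natAbs) (a := 1) (b := 3) Nat.prime_three rfl h3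
      (by simp)
    have h4 := two_mul_add_mod_four (c := 1 * 3) k.reduced (by rfl)
    set M := 2 * k.den ^ 2 + 1 * 3 * k.num.natAbs ^ 2 with hMdef
    obtain ⟨l, hl, -, -, hl4, w, z, hw, hlw⟩ := exists_prime_eq_binary (N := 1) Nat.prime_three rfl
      h4 hcop rfl (Nat.coprime_one_right _) (Nat.coprime_one_right _)
    -- The odd denominator excludes M ≡ 3, hence l ≡ 3, modulo 4, so l is a sum of two squares.
    have hM4 : M % 4 ≠ 3 := by
      rcases Nat.even_or_odd' k.den with ⟨s, hs | hs⟩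
      · omega
      rcases Nat.even_or_odd' k.num.natAbs with ⟨t, ht | ht⟩
      · have : M = 4 * (2 * s * (s + 1)) + 4 * (3 * t ^ 2) + 2 := by rw [hMdef, hs, ht]; ring
        omega
      · have : M = 4 * (2 * s * (s + 1)) + 4 * (3 * t * (t + 1)) + 5 := by
          rw [hMdef, hs, ht]; ring
        omega
    have := Fact.mk hl
    obtain ⟨x, y, hxy⟩ := Nat.Prime.sq_add_sq (p := l) (by omega)
    obtain ⟨x', y', z', h⟩ := exists_sol_of_eq_binary hw hM hlw
      (x := x) (y := y) (by rw [← hxy]; push_cast; ring)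
    exact ⟨x', y', z', by simpa using h⟩

theorem realize_phi_prime {p q : ℕ} (hp : p.Prime) (hq : q.Prime) (hp2 : p % 2 = 1)
    (hq4 : q % 4 = 3) (h1 : jacobiSym (-q) p = -1) (h2 : jacobiSym p q = -1) (k : ℚ) :
    phi.Realize ![(q : ℚ), (p : ℚ), k] ↔ ¬ p ∣ k.den ∧ ¬ q ∣ k.den := by
  rw [realize_phi]
  constructor
  · rintro ⟨x, y, z, h⟩
    simp only [Matrix.cons_val] at h
    -- Exchanging y with z and (a, b) with (-b, -a) preserves the equation, so one descent lemma
    -- serves both primes.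
    refine ⟨not_dvd_den_of_jacobiSym (a := q) (b := p) hp (by simp) h1
      (x := x) (y := y) (z := z) (by exact_mod_cast h),
      not_dvd_den_of_jacobiSym (a := -p) (b := -q) hq (by simp) (by simpa using h2)
      (x := x) (y := z) (z := y) ?_⟩
    push_cast
    linear_combination h
  · rintro ⟨hkp, hkq⟩
    have hpq : p.Coprime q := by
      refine (Nat.coprime_primes hp hq).2 ?_
      rintro rfl
      have := Fact.mk hp
      rw [← jacobiSym.legendreSym.to_jacobiSym, (legendreSym.eq_zero_iff p p).2 (by simp)] at h2
      norm_num at h2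
    -- N = q forces l ≡ 1 modulo q, which makes l a value of x² + qy².
    obtain ⟨l, hl, hql, hlq, -, w, z, hw, hlw⟩ := exists_prime_eq_binary (N := q) hp hp2
      (two_mul_add_mod_four (c := q * p) k.reduced (by rw [Nat.mul_mod, hp2]; omega))
      (coprime_two_mul_add hp hp2 hkp (dvd_mul_left _ _)) (by omega)
      (coprime_two_mul_add hq (by omega) hkq (dvd_mul_right _ _)) hpq
    obtain ⟨x, y, hxy⟩ := exists_eq_sq_add_mul_sq hl hq hql hq4 hlq
    obtain ⟨x', y', z', h⟩ := exists_sol_of_eq_binary hw (natCast_two_mul_add q p k) hlw hxy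
    exact ⟨x', y', z', by simpa using h⟩

/-! ### Choice of the parameters and Robinson's theorem -/

/-- Every odd prime `p` ramifies, together with a suitable `q`, in the quaternion algebra with
parameters `-q, p`. -/
theorem exists_prime_jacobiSym {p : ℕ} (hp : p.Prime) (hp2 : p % 2 = 1) :
    ∃ q : ℕ, q.Prime ∧ q % 4 = 3 ∧ jacobiSym (-q) p = -1 ∧ jacobiSym p q = -1 := by
  have := Fact.mk hp
  obtain ⟨g, hg⟩ := FiniteField.exists_nonsquare (F := ZMod p) (by
    rw [ZMod.ringChar_zmod_n]; omega)
  obtain ⟨n, hn⟩ := ZMod.natCast_zmod_surjective (-g)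
  have hnp : n.Coprime p := by
    refine ((Nat.Prime.coprime_iff_not_dvd hp).2 fun h => hg ?_).symm
    rw [← ZMod.natCast_eq_zero_iff, hn, neg_eq_zero] at h
    exact ⟨0, by simp [h]⟩
  have hc4 : Nat.Coprime 4 p :=
    Nat.Coprime.pow_left 2 ((Nat.coprime_two_left).2 (Nat.odd_iff.2 hp2))
  obtain ⟨m, hm, hm4, hmn⟩ := exists_coprime_modEq (a := 3) (b := n) hc4 (by decide) hnp
  -- q ≡ 3 modulo 4 and -q is a nonresidue modulo p; reciprocity then yields the other symbol.
  obtain ⟨q, -, hq, hqm⟩ := Nat.forall_exists_prime_gt_and_modEq 0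
    (mul_ne_zero four_ne_zero hp.ne_zero) hm
  have hq4 : q % 4 = 3 := (hqm.of_mul_right _).trans hm4
  have hqn : q ≡ n [MOD p] := (hqm.of_mul_left _).trans hmn
  have hJ : jacobiSym (-q) p = -1 := by
    rw [ZMod.nonsquare_iff_jacobiSym_eq_neg_one]
    push_cast
    rwa [(ZMod.natCast_eq_natCast_iff _ _ _).2 hqn, hn, neg_neg]
  refine ⟨q, hq, hq4, hJ, ?_⟩
  rw [jacobiSym.neg _ (Nat.odd_iff.2 hp2)] at hJ
  rcases Nat.odd_mod_four_iff.1 hp2 with h | h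
  · rw [ZMod.χ₄_nat_one_mod_four h, one_mul] at hJ
    rw [jacobiSym.quadratic_reciprocity_one_mod_four h (Nat.odd_iff.2 (by omega)), hJ]
  · rw [ZMod.χ₄_nat_three_mod_four h] at hJ
    rw [jacobiSym.quadratic_reciprocity_three_mod_four h hq4]
    linarith

/-- **Julia Robinson's theorem**: `psi` defines the integers in the field of rational numbers. -/
theorem realize_psi_iff (n : ℚ) : psi.Realize (fun _ => n) ↔ ∃ m : ℤ, (m : ℚ) = n := by
  rw [realize_psi]
  constructor
  · intro h
    have main : ∀ (a b : ℚ) (r₁ r₂ : ℕ), a ≠ 0 → b ≠ 0 → 1 < r₁ → 1 < r₂ →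
        (∀ k, phi.Realize ![a, b, k] ↔ ¬ r₁ ∣ k.den ∧ ¬ r₂ ∣ k.den) →
        ¬ r₁ ∣ n.den ∧ ¬ r₂ ∣ n.den := by
      intro a b r₁ r₂ ha hb h₁ h₂ H
      refine (H n).1 (h a b ⟨ha, hb⟩ ⟨(H 0).2 ?_, fun k hk => (H _).2 ?_⟩)
      · simp only [Rat.den_zero, Nat.dvd_one]
        omega
      · have : (k + 1).den = k.den := by exact_mod_cast Rat.add_natCast_den k 1
        rw [this]
        exact (H k).1 hk
    suffices hden : n.den = 1 from ⟨n.num, Rat.coe_int_num_of_den_eq_one hden⟩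
    by_contra hne
    obtain ⟨p, hp, hdvd⟩ := Nat.exists_prime_and_dvd hne
    rcases hp.eq_two_or_odd with rfl | hp2
    · exact (main 1 3 2 3 one_ne_zero (by norm_num) (by norm_num) (by norm_num)
        realize_phi_one_three).1 hdvd
    · obtain ⟨q, hq, hq4, h1, h2⟩ := exists_prime_jacobiSym hp hp2
      exact (main q p p q (by exact_mod_cast hq.ne_zero) (by exact_mod_cast hp.ne_zero) hp.one_lt
        hq.one_lt (realize_phi_prime hp hq hp2 hq4 h1 h2)).1 hdvd
  · rintro ⟨m, rfl⟩ a b - ⟨h0, hs⟩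
    have hnat : ∀ j : ℕ, phi.Realize ![a, b, (j : ℚ)] := by
      intro j
      induction j with
      | zero => simpa using h0
      | succ j ih => simpa using hs _ ih
    have hj := hnat m.natAbs
    rw [realize_phi] at hj ⊢
    simp only [Matrix.cons_val] at hj ⊢
    have : ((m.natAbs : ℕ) : ℚ) ^ 2 = (m : ℚ) ^ 2 := by
      rw [Nat.cast_natAbs, Int.cast_abs, sq_abs]
    rwa [this] at hj

/-! ### Definability of partial recursive functions in ℚ -/

open FirstOrder FirstOrder.Language

section Arithmetical

/-- The formula defining the natural numbers in `ℚ`. -/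
def isNat : Lring.Formula (Fin 1) :=
  psi ⊓ ∃' ∃' ∃' ∃' ((Term.var (Sum.inl 0) : Lring.Term (Fin 1 ⊕ Fin 4)) ='
    (&0 * &0 + &1 * &1 + &2 * &2 + &3 * &3))

theorem realize_isNat (x : ℚ) : isNat.Realize (fun _ => x) ↔ ∃ n : ℕ, (n : ℚ) = x := by
  have h : isNat.Realize (fun _ => x) ↔ psi.Realize (fun _ => x) ∧
      ∃ a b c d : ℚ, x = a * a + b * b + c * c + d * d := by
    simp only [isNat, Formula.Realize, BoundedFormula.realize_inf, BoundedFormula.realize_ex,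
      BoundedFormula.realize_bdEqual, realize_add, realize_mul, Term.realize_var, Sum.elim_inl]
    rfl
  rw [h, realize_psi_iff]
  constructor
  · rintro ⟨⟨m, rfl⟩, a, b, c, d, h⟩
    have hm : (0 : ℚ) ≤ m := by
      linarith [mul_self_nonneg a, mul_self_nonneg b, mul_self_nonneg c, mul_self_nonneg d]
    lift m to ℕ using (by exact_mod_cast hm)
    exact ⟨m, by simp⟩
  · rintro ⟨n, rfl⟩
    obtain ⟨a, b, c, d, h⟩ := Nat.sum_four_squares n
    refine ⟨⟨n, by simp⟩, a, b, c, d, ?_⟩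
    rw [← h]
    push_cast
    ring

/-- A function of natural numbers given by a term. -/
def IsTerm {α : Type} (f : (α → ℕ) → ℕ) : Prop :=
  ∃ t : Lring.Term α, ∀ v, t.realize (fun i => (v i : ℚ)) = f v

/-- A relation between natural numbers that a formula defines in `ℚ`. -/
def Arithmetical {α : Type} (P : (α → ℕ) → Prop) : Prop :=
  ∃ φ : Lring.Formula α, ∀ v, φ.Realize (fun i => (v i : ℚ)) ↔ P v

variable {α : Type} {f g h : (α → ℕ) → ℕ} {P Q : (α → ℕ) → Prop}

theorem IsTerm.var (i : α) : IsTerm fun v => v i := ⟨Term.var i, fun _ => rfl⟩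

theorem IsTerm.zero : IsTerm fun _ : α → ℕ => 0 :=
  ⟨0, fun v => by rw [realize_zero, Nat.cast_zero]⟩

theorem IsTerm.one : IsTerm fun _ : α → ℕ => 1 :=
  ⟨1, fun v => by rw [realize_one, Nat.cast_one]⟩

theorem IsTerm.add : IsTerm f → IsTerm g → IsTerm fun v => f v + g v := by
  rintro ⟨t, ht⟩ ⟨s, hs⟩
  exact ⟨t + s, fun v => by rw [realize_add, ht, hs, Nat.cast_add]⟩

theorem IsTerm.mul : IsTerm f → IsTerm g → IsTerm fun v => f v * g v := by
  rintro ⟨t, ht⟩ ⟨s, hs⟩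
  exact ⟨t * s, fun v => by rw [realize_mul, ht, hs, Nat.cast_mul]⟩

namespace Arithmetical

theorem eq : IsTerm f → IsTerm g → Arithmetical fun v => f v = g v := by
  rintro ⟨t, ht⟩ ⟨s, hs⟩
  refine ⟨Term.equal t s, fun v => ?_⟩
  rw [Formula.realize_equal, ht, hs, Nat.cast_inj]

theorem not : Arithmetical P → Arithmetical fun v => ¬ P v := by
  rintro ⟨φ, hφ⟩
  exact ⟨φ.not, fun v => by rw [Formula.realize_not, hφ]⟩

theorem and : Arithmetical P → Arithmetical Q → Arithmetical fun v => P v ∧ Q v := by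
  rintro ⟨φ, hφ⟩ ⟨ψ, hψ⟩
  exact ⟨φ ⊓ ψ, fun v => by rw [Formula.realize_inf, hφ, hψ]⟩

theorem of_iff (hP : Arithmetical P) (h : ∀ v, Q v ↔ P v) : Arithmetical Q := by
  rwa [show Q = P from funext fun v => propext (h v)]

theorem or (hP : Arithmetical P) (hQ : Arithmetical Q) : Arithmetical fun v => P v ∨ Q v :=
  (hP.not.and hQ.not).not.of_iff fun v => by tauto

theorem imp (hP : Arithmetical P) (hQ : Arithmetical Q) : Arithmetical fun v => P v → Q v :=
  (hP.and hQ.not).not.of_iff fun v => by tauto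

/-- A quantifier over ℕ becomes one over ℚ relativized to `isNat`. -/
theorem ex {P : (α → ℕ) → ℕ → Prop}
    (h : Arithmetical fun w : α ⊕ Unit → ℕ => P (fun i => w (Sum.inl i)) (w (Sum.inr ()))) :
    Arithmetical fun v => ∃ x, P v x := by
  obtain ⟨φ, hφ⟩ := h
  refine ⟨Formula.iExs Unit (isNat.relabel (fun _ => Sum.inr ()) ⊓ φ), fun v => ?_⟩
  have key : ∀ x : ℕ, (fun i => ((Sum.elim v (fun _ => x) i : ℕ) : ℚ)) =
      Sum.elim (fun i => (v i : ℚ)) (fun _ : Unit => (x : ℚ)) := by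
    intro x
    funext i
    cases i <;> rfl
  rw [Formula.realize_iExs]
  simp only [Formula.realize_inf, Formula.realize_relabel]
  constructor
  · rintro ⟨i, h1, h2⟩
    obtain ⟨x, hx⟩ := (realize_isNat (i ())).1 h1
    have hi : i = fun _ => (x : ℚ) := funext fun _ => hx.symm
    rw [hi, ← key x, hφ] at h2
    exact ⟨x, h2⟩
  · rintro ⟨x, hx⟩
    refine ⟨fun _ => x, (realize_isNat x).2 ⟨x, rfl⟩, ?_⟩
    rw [← key x, hφ]
    exact hx

theorem all {P : (α → ℕ) → ℕ → Prop}
    (h : Arithmetical fun w : α ⊕ Unit → ℕ => P (fun i => w (Sum.inl i)) (w (Sum.inr ()))) :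
    Arithmetical fun v => ∀ x, P v x :=
  (ex (P := fun v x => ¬ P v x) h.not).not.of_iff fun v => by push Not; rfl

theorem subst {β : Type} {R : (β → ℕ) → Prop} {f : β → (α → ℕ) → ℕ} (hR : Arithmetical R)
    (hf : ∀ i, IsTerm (f i)) : Arithmetical fun v => R fun i => f i v := by
  obtain ⟨φ, hφ⟩ := hR
  choose t ht using hf
  refine ⟨BoundedFormula.subst φ t, fun v => ?_⟩
  refine BoundedFormula.realize_subst.trans (Iff.trans ?_ (hφ _))
  simp only [ht]
  rfl

theorem subst₂ {R : ℕ → ℕ → Prop} (hR : Arithmetical fun v : Fin 2 → ℕ => R (v 0) (v 1))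
    (hf : IsTerm f) (hg : IsTerm g) : Arithmetical fun v => R (f v) (g v) :=
  hR.subst (f := ![f, g]) (by simp [Fin.forall_fin_succ, hf, hg])

theorem subst₃ {R : ℕ → ℕ → ℕ → Prop}
    (hR : Arithmetical fun v : Fin 3 → ℕ => R (v 0) (v 1) (v 2))
    (hf : IsTerm f) (hg : IsTerm g) (hh : IsTerm h) :
    Arithmetical fun v => R (f v) (g v) (h v) :=
  hR.subst (f := ![f, g, h]) (by simp [Fin.forall_fin_succ, hf, hg, hh])

theorem lt (hf : IsTerm f) (hg : IsTerm g) : Arithmetical fun v => f v < g v := by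
  refine subst₂ (R := fun a b => a < b) ?_ hf hg
  refine (ex (P := fun v k => v 0 + k + 1 = v 1) ?_).of_iff fun v => ?_
  · exact eq (((IsTerm.var _).add (.var _)).add .one) (.var _)
  · rw [Nat.lt_iff_add_one_le, le_iff_exists_add]
    exact exists_congr fun k => by omega

theorem pair_eq (hf : IsTerm f) (hg : IsTerm g) (hh : IsTerm h) :
    Arithmetical fun v => Nat.pair (f v) (g v) = h v := by
  refine (((lt hf hg).and (eq ((hg.mul hg).add hf) hh)).or ((lt hf hg).not.and
    (eq (((hf.mul hf).add hf).add hg) hh))).of_iff fun v => ?_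
  rw [Nat.pair]
  split_ifs <;> simp_all

theorem mod_eq (hf : IsTerm f) (hg : IsTerm g) (hh : IsTerm h) :
    Arithmetical fun v => f v % (g v + 1) = h v := by
  refine subst₃ (R := fun a b c => a % (b + 1) = c) ?_ hf hg hh
  refine ((lt (.var 2) ((IsTerm.var 1).add .one)).and
    (ex (P := fun v k => v 0 = (v 1 + 1) * k + v 2) (eq (.var _)
      (((((IsTerm.var _).add .one).mul (.var _))).add (.var _))))).of_iff fun v => ?_
  rw [Nat.mod_eq_iff]
  simp

theorem beta_eq (hf : IsTerm f) (hg : IsTerm g) (hh : IsTerm h) :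
    Arithmetical fun v => Nat.beta (f v) (g v) = h v := by
  refine subst₃ (R := fun a b c => Nat.beta a b = c) ?_ hf hg hh
  refine (ex (P := fun v c => ∃ d, Nat.pair c d = v 0 ∧ c % ((v 1 + 1) * d + 1) = v 2)
    (ex ((pair_eq (.var _) (.var _) (.var _)).and
      (mod_eq (.var _) (((IsTerm.var _).add .one).mul (.var _)) (.var _))))).of_iff fun v => ?_
  constructor
  · exact fun h => ⟨_, _, Nat.pair_unpair _, h⟩
  · rintro ⟨c, d, h1, h2⟩
    rw [← h1, Nat.beta, Nat.unpair_pair]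
    exact h2

end Arithmetical

/-- Gödel's β lemma: one number codes an initial segment, here of length n + 1 since the value at n
is needed. -/
theorem exists_beta_eq (s : ℕ → ℕ) (n : ℕ) : ∃ c, ∀ i ≤ n, Nat.beta c i = s i := by
  refine ⟨Nat.unbeta (List.ofFn fun i : Fin (n + 1) => s i), fun i hi => ?_⟩
  have := Nat.beta_unbeta_coe (List.ofFn fun i : Fin (n + 1) => s i)
    ⟨i, by rw [List.length_ofFn]; omega⟩
  exact this.trans (by simp only [Fin.getElem_fin, List.getElem_ofFn])

/-- Membership in a primitive recursion, by a code of the sequence of values. -/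
theorem mem_nat_rec_iff (a : Part ℕ) (g : ℕ → ℕ → Part ℕ) (m y : ℕ) :
    y ∈ (Nat.rec a (fun i IH => IH.bind (g i)) m : Part ℕ) ↔
      ∃ c, (Nat.beta c 0 ∈ a ∧ Nat.beta c m = y) ∧
        ∀ i, i < m → Nat.beta c (i + 1) ∈ g i (Nat.beta c i) := by
  constructor
  · intro hy
    suffices ∃ s : ℕ → ℕ, s 0 ∈ a ∧ s m = y ∧ ∀ i < m, s (i + 1) ∈ g i (s i) by
      obtain ⟨s, h0, hm, hs⟩ := this
      obtain ⟨c, hc⟩ := exists_beta_eq s m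
      refine ⟨c, ⟨by rwa [hc 0 (Nat.zero_le _)], by rwa [hc m le_rfl]⟩, fun i hi => ?_⟩
      rw [hc i hi.le, hc (i + 1) hi]
      exact hs i hi
    induction m generalizing y with
    | zero => exact ⟨fun _ => y, hy, rfl, fun i hi => absurd hi (Nat.not_lt_zero _)⟩
    | succ m ih =>
      obtain ⟨u, hu, hy⟩ := Part.mem_bind_iff.1 hy
      obtain ⟨s, h0, hm, hs⟩ := ih u hu
      refine ⟨fun i => if i ≤ m then s i else y, by simpa using h0, by simp, fun i hi => ?_⟩
      rcases Nat.lt_succ_iff_lt_or_eq.1 hi with h | rfl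
      · simp only [h.le, if_true, Nat.succ_le_of_lt h]
        exact hs i h
      · simpa [hm] using hy
  · rintro ⟨c, ⟨h0, rfl⟩, hs⟩
    induction m with
    | zero => exact h0
    | succ m ih =>
      exact Part.mem_bind_iff.2 ⟨_, ih fun i hi => hs i (by omega), hs m (by omega)⟩

/-- The graph of a partial recursive function is arithmetical. -/
theorem arithmetical_of_partrec {f : ℕ →. ℕ} (hf : Nat.Partrec f) :
    Arithmetical fun v : Fin 2 → ℕ => v 1 ∈ f (v 0) := by
  induction hf with
  | zero =>
    refine (Arithmetical.eq (.var 1) .zero).of_iff fun v => ?_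
    exact Part.mem_some_iff
  | succ =>
    refine (Arithmetical.eq (.var 1) ((IsTerm.var 0).add .one)).of_iff fun v => ?_
    exact Part.mem_some_iff
  | left =>
    refine (Arithmetical.ex (P := fun v k => Nat.pair (v 1) k = v 0)
      (.pair_eq (.var _) (.var _) (.var _))).of_iff fun v => ?_
    refine Part.mem_some_iff.trans ⟨fun h => ⟨(v 0).unpair.2, by
      rw [show v 1 = (v 0).unpair.1 from h, Nat.pair_unpair]⟩, ?_⟩
    rintro ⟨k, hk⟩
    simp [← hk]
  | right =>
    refine (Arithmetical.ex (P := fun v k => Nat.pair k (v 1) = v 0)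
      (.pair_eq (.var _) (.var _) (.var _))).of_iff fun v => ?_
    refine Part.mem_some_iff.trans ⟨fun h => ⟨(v 0).unpair.1, by
      rw [show v 1 = (v 0).unpair.2 from h, Nat.pair_unpair]⟩, ?_⟩
    rintro ⟨k, hk⟩
    simp [← hk]
  | @pair f g _ _ hf hg =>
    refine (Arithmetical.ex (P := fun v a => ∃ b, a ∈ f (v 0) ∧ b ∈ g (v 0) ∧ Nat.pair a b = v 1)
      (.ex ((hf.subst₂ (R := fun x y => y ∈ f x) (.var _) (.var _)).and
        ((hg.subst₂ (R := fun x y => y ∈ g x) (.var _) (.var _)).and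
          (.pair_eq (.var _) (.var _) (.var _)))))).of_iff fun v => ?_
    simp [seq_eq_bind_map]
  | @comp f g _ _ hf hg =>
    refine (Arithmetical.ex (P := fun v a => a ∈ g (v 0) ∧ v 1 ∈ f a)
      ((hg.subst₂ (R := fun x y => y ∈ g x) (.var _) (.var _)).and
        (hf.subst₂ (R := fun x y => y ∈ f x) (.var _) (.var _)))).of_iff fun v => ?_
    exact Part.mem_bind_iff
  | @prec f g _ _ hf hg =>
    -- β and pairing are not terms, so their values are named by extra existential quantifiers.
    have hb : Arithmetical fun v : Fin 3 → ℕ => Nat.beta (v 0) (v 1) ∈ f (v 2) :=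
      (Arithmetical.ex (P := fun v u => Nat.beta (v 0) (v 1) = u ∧ u ∈ f (v 2))
        ((Arithmetical.beta_eq (.var _) (.var _) (.var _)).and
          (hf.subst₂ (R := fun x y => y ∈ f x) (.var _) (.var _)))).of_iff fun v => by simp
    have hs : Arithmetical fun v : Fin 3 → ℕ => Nat.beta (v 0) (v 1 + 1) ∈
        g (Nat.pair (v 2) (Nat.pair (v 1) (Nat.beta (v 0) (v 1)))) :=
      (Arithmetical.ex (P := fun v u => ∃ w c d, (Nat.beta (v 0) (v 1) = u ∧
          Nat.beta (v 0) (v 1 + 1) = w) ∧ (Nat.pair (v 1) u = c ∧ Nat.pair (v 2) c = d) ∧ w ∈ g d)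
        (.ex (.ex (.ex (((Arithmetical.beta_eq (.var _) (.var _) (.var _)).and
          (.beta_eq (.var _) ((IsTerm.var _).add .one) (.var _))).and
          (((Arithmetical.pair_eq (.var _) (.var _) (.var _)).and
            (.pair_eq (.var _) (.var _) (.var _))).and
          (hg.subst₂ (R := fun x y => y ∈ g x) (.var _) (.var _)))))))).of_iff fun v => by simp
    refine (Arithmetical.ex (P := fun v a => ∃ m c, Nat.pair a m = v 0 ∧
      (Nat.beta c 0 ∈ f a ∧ Nat.beta c m = v 1) ∧ ∀ i, i < m →
        Nat.beta c (i + 1) ∈ g (Nat.pair a (Nat.pair i (Nat.beta c i))))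
      (.ex (.ex ((Arithmetical.pair_eq (.var _) (.var _) (.var _)).and
        (((hb.subst₃ (R := fun x y z => Nat.beta x y ∈ f z) (.var _) .zero (.var _)).and
          (.beta_eq (.var _) (.var _) (.var _))).and
        (.all ((Arithmetical.lt (.var _) (.var _)).imp
          (hs.subst₃ (R := fun x y z => Nat.beta x (y + 1) ∈
            g (Nat.pair z (Nat.pair y (Nat.beta x y)))) (.var _) (.var _) (.var _))))))))).of_iff
      fun v => ?_
    rw [Nat.unpaired]
    refine (mem_nat_rec_iff (f (v 0).unpair.1)
      (fun i u => g (Nat.pair (v 0).unpair.1 (Nat.pair i u))) (v 0).unpair.2 (v 1)).trans ?_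
    constructor
    · rintro ⟨c, h⟩
      exact ⟨_, _, c, Nat.pair_unpair _, h⟩
    · rintro ⟨a, m, c, h1, h⟩
      rw [← h1, Nat.unpair_pair]
      exact ⟨c, h⟩
  | @rfind f _ hf =>
    have hc : Arithmetical fun v : Fin 3 → ℕ => v 2 ∈ f (Nat.pair (v 0) (v 1)) :=
      (Arithmetical.ex (P := fun v c => Nat.pair (v 0) (v 1) = c ∧ v 2 ∈ f c)
        ((Arithmetical.pair_eq (.var _) (.var _) (.var _)).and
          (hf.subst₂ (R := fun x y => y ∈ f x) (.var _) (.var _)))).of_iff fun v => by simp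
    -- Minimization requires f to be defined, and nonzero, at every smaller argument; hence the
    -- inner existential.
    refine ((hc.subst₃ (R := fun x y z => z ∈ f (Nat.pair x y)) (.var 0) (.var 1) .zero).and
      (Arithmetical.all (P := fun v m => m < v 1 → ∃ k, k ∈ f (Nat.pair (v 0) m) ∧ ¬ k = 0)
        ((Arithmetical.lt (.var _) (.var _)).imp (.ex
          ((hc.subst₃ (R := fun x y z => z ∈ f (Nat.pair x y)) (.var _) (.var _) (.var _)).and
            (Arithmetical.eq (.var _) .zero).not))))).of_iff fun v => ?_
    refine Nat.mem_rfind.trans ?_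
    simp

end Arithmetical

/-! ### Reduction of the halting problem -/

section Undecidability

/-- The numeral of a natural number. -/
def numeral (n : ℕ) : Lring.Term (Empty ⊕ Fin 1) :=
  Nat.rec 0 (fun _ t => 1 + t) n

theorem realize_numeral (n : ℕ) (v : Empty ⊕ Fin 1 → ℚ) : (numeral n).realize v = n := by
  induction n with
  | zero => rw [Nat.cast_zero]; rfl
  | succ n ih =>
    rw [show numeral (n + 1) = 1 + numeral n from rfl, realize_add, ih, realize_one]
    push_cast
    ring

/-- With `1` as the left summand, Polish notation grows only at the front. -/
theorem termString_numeral (n : ℕ) : termString (numeral n) =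
    Nat.rec [Symb.zero] (fun _ l => Symb.add :: Symb.one :: l) n := by
  induction n with
  | zero => rfl
  | succ n ih => exact congrArg (Symb.add :: Symb.one :: ·) ih

/-- The sentence `∀ x, x = n → θ(x)`. -/
def instanceAt (θ : Lring.BoundedFormula Empty 1) (n : ℕ) : Lring.Sentence :=
  ∀' (((&0 : Lring.Term (Empty ⊕ Fin 1)) =' numeral n) ⟹ θ)

theorem realize_instanceAt (θ : Lring.Formula (Fin 1)) (n : ℕ) :
    ℚ ⊨ instanceAt (BoundedFormula.relabel (k := 0) Sum.inr θ) n ↔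
      θ.Realize (fun _ => (n : ℚ)) := by
  simp only [instanceAt, Sentence.Realize, Formula.Realize, BoundedFormula.realize_all,
    BoundedFormula.realize_imp, BoundedFormula.realize_bdEqual, realize_numeral]
  have h : ∀ (x : ℚ) (d : Empty → ℚ) (e e' : Fin 0 → ℚ),
      (BoundedFormula.relabel (k := 0) (Sum.inr : Fin 1 → Empty ⊕ Fin 1) θ).Realize
        d (Fin.snoc e x) ↔ BoundedFormula.Realize θ (fun _ => x) e' := by
    intro x d e e'
    rw [BoundedFormula.realize_relabel]
    refine iff_of_eq (congrArg₂ _ (funext fun i => ?_) (Subsingleton.elim _ _))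
    fin_cases i
    rfl
  constructor
  · exact fun H => (h n _ _ _).1 (H n rfl)
  · rintro H x rfl
    exact (h n _ _ _).2 H

/-- The numeral enters through an equation rather than by substitution, so it is the only part of
the string that varies with n. -/
theorem computable_formulaString_instanceAt (θ : Lring.BoundedFormula Empty 1) :
    Computable fun n => formulaString (instanceAt θ n) := by
  have hs : (fun n => formulaString (instanceAt θ n)) = fun n =>
      ([Symb.all, Symb.var, Symb.imp, Symb.eq, Symb.var] ++
        (Nat.rec [Symb.zero] (fun _ l => Symb.add :: Symb.one :: l) n : List Symb)) ++
          formulaString θ := by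
    funext n
    rw [← termString_numeral]
    rfl
  rw [hs]
  have hrec : Primrec fun n : ℕ =>
      (Nat.rec [Symb.zero] (fun _ l => Symb.add :: Symb.one :: l) n : List Symb) :=
    Primrec.nat_rec₁ _ (Primrec.list_cons.comp (.const _)
      (Primrec.list_cons.comp (.const _) Primrec.snd))
  exact (Primrec.list_append.comp (Primrec.list_append.comp (.const _) hrec) (.const _)).to_comp

/-- "The program with code e halts on input 0" is arithmetical in e; a decision procedure applied to
its instances would solve the halting problem. -/
theorem not_theoryDecidable : ¬ TheoryDecidable (Lring.completeTheory ℚ) := by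
  rintro ⟨f, hf, hdec⟩
  have hU : Nat.Partrec fun e => (Denumerable.ofNat Nat.Partrec.Code e).eval 0 :=
    Partrec.nat_iff.1 (Nat.Partrec.Code.eval_part.comp (Computable.ofNat _) (Computable.const 0))
  obtain ⟨θ, hθ⟩ : Arithmetical fun v : Fin 1 → ℕ =>
      ∃ y, y ∈ (Denumerable.ofNat Nat.Partrec.Code (v 0)).eval 0 :=
    .ex ((arithmetical_of_partrec hU).subst₂ (R := fun x y =>
      y ∈ (Denumerable.ofNat Nat.Partrec.Code x).eval 0) (.var _) (.var _))
  refine ComputablePred.halting_problem 0 (ComputablePred.computable_iff.2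
    ⟨fun c => f (formulaString (instanceAt (BoundedFormula.relabel (k := 0) Sum.inr θ)
      (Encodable.encode c))), hf.comp ((computable_formulaString_instanceAt _).comp
        Computable.encode), ?_⟩)
  funext c
  refine propext (Iff.symm ((hdec _).trans (mem_completeTheory.trans
    ((realize_instanceAt θ _).trans ((hθ fun _ => Encodable.encode c).trans ?_)))))
  change (∃ y, y ∈ (Denumerable.ofNat Nat.Partrec.Code (Encodable.encode c)).eval 0) ↔ _
  rw [Denumerable.ofNat_encode, Part.dom_iff_mem]

end Undecidability

end RingTheoryOfRat

theorem mainTheorem6 :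
    (∀ n : ℚ, RingTheoryOfRat.psi.Realize (fun _ => n) ↔ ∃ m : ℤ, (m : ℚ) = n) ∧
      ¬ RingTheoryOfRat.TheoryDecidable (RingTheoryOfRat.Lring.completeTheory ℚ) :=
  ⟨RingTheoryOfRat.realize_psi_iff, RingTheoryOfRat.not_theoryDecidable⟩
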